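/- Let $T$ be either the finite non-empty powerset monad $Q$ or the finitely supported distribution monad $D$ on sets, and let ${\sf supp}:T\to P$ be the inclusion, respectively the support map, into the powerset monad. Let $\delta:TP\to PT$ be the weak distributive law with $\delta(\{U_i\}_i)=\{\bigcup_i V_i\mid \emptyset\neq V_i\subseteq U_i \text{ finite}\}$ for $T=Q$, and $\delta([U_i\mapsto p_i]_i)=\{\mu^D[\varphi_i\mapsto p_i]\mid {\sf supp}\,\varphi_i\subseteq U_i\}$ for $T=D$. Let ${\sf cl}=P\mu^T\circ\delta\circ\eta^T$ be the associated convex closure, and $\widetilde{PT}$ the composite monad: $\widetilde{PT}(X)$ is the set of all $\mathcal U\subseteq T(X)$ with ${\sf cl}(\mathcal U)=\mathcal U$, the unit is $\eta^P\eta^T$ and the multiplication is $\mu^P\mu^T\circ P\delta$; sequences have joins $\bigvee_n \mathcal U_n={\sf cl}(\bigcup_n\mathcal U_n)$. Write $\odot$ for Kleisli composition. Fix sets $A,B,X$ and put $H(Y)=B+A\times Y$ and $H_X(Y)=X\times H(Y)$. Their initial algebras are the set $A^*B$ of finite traces and the set $(XA)^*XB$ of executions. Write $\overline F$ and $\widehat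 F$ for the canonical extensions (through the strengths) of $F=H, H_X^n$ to ${\bf Kl}(\widetilde{PT})$ and ${\bf Kl}(T)$, and let $K:{\bf Kl}(T)\to{\bf Kl}(\widetilde{PT})$ be $K(f)(x)={\sf cl}\{f(x)\}$. Let $f_{\pi_2}:(XA)^*XB\to A^*B$, $x_0a_1x_1\dots a_nx_nb\mapsto a_1\dots a_nb$, and $f_{\overline{\pi_2}}=\eta^{\widetilde{PT}}\circ f_{\pi_2}$. Let $c:X\to\widetilde{PT}H(X)$ be a coalgebra, and let $c^*:X\to\widetilde{PT}H_X(X)$ be $c^*={\sf stl}\circ\langle{\rm id},c\rangle$. A *strategy* $\sigma\in\Sigma_c(x)$ from $x\in X$ is a chain of maps with $\sigma_0:1\to T(X)$ picking $\eta^T(x)$ and $\sigma_{n+1}:{\rm Im}(\sigma_n)\to T(H_X^{n+1}(X))$ for $n\in\omega$, where ${\rm Im}(\sigma_n)\subseteq H_X^n(X)$ is the union of the supports of the values of $\sigma_n$, such that $\widehat{H_X^n}(\widehat{\pi_1})\odot\sigma_{n+1}$ is the inclusion ${\rm Im}(\sigma_n)\rightarrowtail H^n_X(X)$ in ${\bf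 Kl}(T)$ and $K(\sigma_{n+1})\sqsubseteq\overline{H_X^n}(c^*)$ on ${\rm Im}(\sigma_n)$, where $\sqsubseteq$ is pointwise inclusion. Corestricting each $\sigma_n$ to ${\rm Im}(\sigma_n)$ and composing in ${\bf Kl}(T)$ gives the $n$-step partial outcome ${\sf plays}^\sigma_n(x):1\to T(H_X^n(X))$. With $!:X\to\widetilde{PT}(\emptyset)$ the unique map and $\kappa_n:H_X^n(\emptyset)\to (XA)^*XB$ the canonical maps from the initial sequence, the completed outcome is $${\sf plays}^\sigma_c(x)=\bigvee_{n\in\omega}\ \overline{\kappa_n}\odot\overline{H_X^n}(!)\odot K({\sf plays}_n^\sigma(x))\ \in\ \widetilde{PT}((XA)^*XB).$$ The strategy $\sigma$ *forces* $U\in T(A^*B)$ if $U=T(f_{\pi_2})(V)$ for some $V\in{\sf plays}^\sigma_c(x)$. Then: 1. For every $x\in X$ and $\sigma\in\Sigma_c(x)$, ${\sf plays}^\sigma_c(x)$ is the unique $m\in\widetilde{PT}((XA)^*XB)$ with $\pi_n\odot m=\overline{H_X^n}(!)\odot K({\sf plays}^\sigma_n(x))$ for all $n$, where $\pi_n$ is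 the projection of the embedding $\overline{\kappa_n}$ (it inverts $\kappa_n$ on its range and is $\emptyset$ elsewhere). 2. There is exactly one *trace map* ${\sf tr}_c:X\to\widetilde{PT}(A^*B)$, i.e. exactly one $\overline H$-coalgebra morphism in ${\bf Kl}(\widetilde{PT})$ from $(X,c)$ to $A^*B$ with the (lifted) inverse of the initial $H$-algebra structure. 3. For every $x\in X$, the union $\bigcup_{\sigma\in\Sigma_c(x)}{\sf plays}^\sigma_c(x)$ is convex, hence an element of $\widetilde{PT}((XA)^*XB)$, and $${\sf tr}_c(x)=f_{\overline{\pi_2}}\odot\bigcup_{\sigma\in\Sigma_c(x)}{\sf plays}^\sigma_c(x).$$ 4. For every $x\in X$ and $U\in T(A^*B)$: $U\in{\sf tr}_c(x)$ if and only if some strategy from $x$ forces $U$. -/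

import Mathlib

universe u

namespace TwoPlayer

/-! ### The two environment monads -/

/-- The finite non-empty powerset `Q X`. -/
def Q (X : Type u) : Type u := {s : Set X // s.Finite ∧ s.Nonempty}

/-- The finitely supported probability distributions `D X`. -/
def D (X : Type u) : Type u := {p : PMF X // p.support.Finite}

noncomputable instance : Monad Q where
  pure x := ⟨{x}, Set.finite_singleton x, Set.singleton_nonempty x⟩
  bind s f := ⟨⋃ x ∈ s.1, (f x).1, s.2.1.biUnion fun x _ => (f x).2.1,
    s.2.2.elim fun x hx => (f x).2.2.elim fun y hy => ⟨y, Set.mem_biUnion hx hy⟩⟩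

noncomputable instance : Monad D where
  pure x := ⟨PMF.pure x, by rw [PMF.support_pure]; exact Set.finite_singleton x⟩
  bind p f := ⟨p.1.bind fun x => (f x).1, by
    rw [PMF.support_bind]; exact p.2.biUnion fun x _ => (f x).2⟩

/-- The kind of environment: nondeterministic or probabilistic. -/
inductive Env : Type
  | nondet
  | prob

/-- The environment monad `T`, which is `Q` or `D`. -/
def Env.T : Env → Type u → Type u
  | .nondet => Q
  | .prob => D

noncomputable instance instMonadT (e : Env) : Monad e.T :=
  match e with
  | .nondet => inferInstanceAs (Monad Q)
  | .prob => inferInstanceAs (Monad D)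

/-- The monad morphism `supp : T → P`: the inclusion for `Q`, the support for `D`. -/
def supp : {e : Env} → {X : Type u} → e.T X → Set X
  | .nondet, _, s => s.1
  | .prob, _, p => p.1.support

/-- An element of `T X` whose support lies in `S`, seen as an element of `T S`. -/
noncomputable def corestrict : {e : Env} → {X : Type u} → {S : Set X} →
    (v : e.T X) → supp v ⊆ S → e.T S
  | .nondet, _, _, v, h => ⟨Subtype.val ⁻¹' v.1, v.2.1.preimage Subtype.val_injective.injOn,
      v.2.2.elim fun x hx => ⟨⟨x, h hx⟩, hx⟩⟩
  | .prob, _, _, v, h => ⟨v.1.bindOnSupport fun x hx => PMF.pure ⟨x, h hx⟩, by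
      rw [PMF.support_bindOnSupport]
      refine v.2.biUnion' fun x hx => ?_
      rw [PMF.support_pure]
      exact Set.finite_singleton _⟩

section Facts

variable {e : Env} {X Y Z : Type u}

theorem supp_nonempty (v : e.T X) : (supp v).Nonempty := by
  cases e
  · exact v.2.2
  · exact v.1.support_nonempty

theorem supp_pure (x : X) : supp (pure x : e.T X) = {x} := by
  cases e
  · rfl
  · exact PMF.support_pure x

theorem supp_bind (v : e.T X) (f : X → e.T Y) : supp (v >>= f) = ⋃ x ∈ supp v, supp (f x) := by
  cases e
  · rfl
  · exact PMF.support_bind _ _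

theorem map_eq (f : X → Y) (v : e.T X) : f <$> v = v >>= fun x => pure (f x) := by
  cases e <;> rfl

theorem pure_bind' (x : X) (f : X → e.T Y) : (pure x : e.T X) >>= f = f x := by
  cases e
  · exact Subtype.ext (Set.biUnion_singleton x _)
  · exact Subtype.ext (PMF.pure_bind x _)

theorem bind_pure' (v : e.T X) : v >>= pure = v := by
  cases e
  · exact Subtype.ext (Set.biUnion_of_singleton v.1)
  · exact Subtype.ext (PMF.bind_pure v.1)

theorem bind_assoc' (v : e.T X) (f : X → e.T Y) (g : Y → e.T Z) :
    v >>= f >>= g = v >>= fun x => f x >>= g := by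
  cases e
  · exact Subtype.ext (Set.biUnion_iUnion _ _ |>.trans (by simp; rfl))
  · exact Subtype.ext (PMF.bind_bind v.1 _ _)

theorem bind_congr' (v : e.T X) {f g : X → e.T Y} (h : ∀ x ∈ supp v, f x = g x) :
    v >>= f = v >>= g := by
  cases e
  · exact Subtype.ext (Set.iUnion₂_congr fun x hx => by rw [h x hx])
  · refine Subtype.ext (PMF.ext fun y => tsum_congr fun x => ?_)
    by_cases hx : v.1 x = 0
    · simp [hx]
    · change v.1 x * (f x).1 y = v.1 x * (g x).1 y
      rw [h x hx]

/-- Every element of `T (X × Z)` splits into its first marginal and a conditional kernel. -/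
theorem exists_kernel (w : e.T (X × Z)) : ∃ k : X → e.T Z,
    (∀ x, (∃ z, (x, z) ∈ supp w) → ∀ z ∈ supp (k x), (x, z) ∈ supp w) ∧
      w = w >>= fun p => k p.1 >>= fun z => pure (p.1, z) := by
  classical
  cases e
  · obtain ⟨p₀, hp₀⟩ := w.2.2
    have hk : ∀ x, ∃ k : Q Z, (∃ z, (x, z) ∈ w.1) → k.1 = {z | (x, z) ∈ w.1} := by
      intro x
      by_cases hx : ∃ z, (x, z) ∈ w.1
      · refine ⟨⟨{z | (x, z) ∈ w.1}, ?_, hx⟩, fun _ => rfl⟩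
        exact w.2.1.preimage (f := fun z => (x, z)) (fun a _ b _ hab => by simpa using hab)
      · exact ⟨⟨{p₀.2}, Set.finite_singleton _, Set.singleton_nonempty _⟩, fun h => (hx h).elim⟩
    choose k hk using hk
    refine ⟨k, fun x hx z hz => ?_, Subtype.ext ?_⟩
    · have : z ∈ (k x).1 := hz
      rw [hk x hx] at this
      exact this
    · change w.1 = ⋃ p ∈ w.1, ⋃ z ∈ (k p.1).1, {(p.1, z)}
      ext ⟨x, z⟩
      simp only [Set.mem_iUnion, Set.mem_singleton_iff, Prod.mk.injEq, exists_prop]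
      constructor
      · intro h
        refine ⟨(x, z), h, z, ?_, rfl, rfl⟩
        rw [hk x ⟨z, h⟩]
        exact h
      · rintro ⟨⟨x', z'⟩, h, z'', h', rfl, rfl⟩
        rw [hk _ ⟨z', h⟩] at h'
        exact h'
  · obtain ⟨p₀, hp₀⟩ := w.1.support_nonempty
    have htop : ∀ x, ∑' z, w.1 (x, z) ≠ ⊤ := fun x =>
      ne_top_of_le_ne_top (b := 1) (by simp) (by
        rw [← w.1.tsum_coe, ENNReal.tsum_prod']
        exact ENNReal.le_tsum x)
    have hk : ∀ x, ∃ k : D Z, (∃ z, (x, z) ∈ w.1.support) →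
        ∀ z, k.1 z = w.1 (x, z) * (∑' z, w.1 (x, z))⁻¹ := by
      intro x
      by_cases hx : ∃ z, (x, z) ∈ w.1.support
      · have h0 : ∑' z, w.1 (x, z) ≠ 0 := by
          obtain ⟨z, hz⟩ := hx
          exact fun h => hz (ENNReal.tsum_eq_zero.1 h z)
        refine ⟨⟨PMF.normalize _ h0 (htop x), ?_⟩, fun _ z => rfl⟩
        rw [PMF.support_normalize]
        exact w.2.preimage (f := fun z => (x, z)) (fun a _ b _ hab => by simpa using hab)
      · exact ⟨pure p₀.2, fun h => (hx h).elim⟩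
    choose k hk using hk
    refine ⟨k, fun x hx z hz => ?_, Subtype.ext (PMF.ext ?_)⟩
    · have : (k x).1 z ≠ 0 := hz
      rw [hk x hx] at this
      exact left_ne_zero_of_mul this
    · rintro ⟨x, z⟩
      change w.1 (x, z) = ∑' p, w.1 p * ∑' z', (k p.1).1 z' * PMF.pure (p.1, z') (x, z)
      have h1 : ∀ p : X × Z, (∑' z', (k p.1).1 z' * PMF.pure (p.1, z') (x, z))
          = if p.1 = x then (k x).1 z else 0 := by
        rintro ⟨x', z''⟩
        rw [tsum_eq_single z]
        · by_cases h : x' = x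
          · subst h; simp
          · simp [PMF.pure_apply, h, Ne.symm h]
        · intro z' hz'
          simp [PMF.pure_apply, hz'.symm]
      simp_rw [h1]
      rw [ENNReal.tsum_prod', tsum_eq_single x]
      · simp only [if_true]
        rw [ENNReal.tsum_mul_right]
        by_cases hx : ∃ z, (x, z) ∈ w.1.support
        · rw [hk x hx, mul_comm, mul_assoc, ENNReal.inv_mul_cancel _ (htop x), mul_one]
          obtain ⟨z, hz⟩ := hx
          exact fun h => hz (ENNReal.tsum_eq_zero.1 h z)
        · have : ∀ z, w.1 (x, z) = 0 := fun z => by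
            by_contra h
            exact hx ⟨z, h⟩
          simp [this]
      · intro x' hx'
        simp [hx']

end Facts

/-! ### The weak distributive law and the composite monad -/

/-- The weak distributive law `δ : T P → P T`. On `Q` it sends a finite family `{Uᵢ}` to the set of
all `⋃ Vᵢ` with `∅ ≠ Vᵢ ⊆ Uᵢ` finite; on `D` it sends `[Uᵢ ↦ pᵢ]` to the set of all averages
`μ [φᵢ ↦ pᵢ]` with `supp φᵢ ⊆ Uᵢ`. -/
def dlaw {e : Env} {X : Type u} (w : e.T (Set X)) : Set (e.T X) :=
  {v | ∃ φ : Set X → e.T X, (∀ U ∈ supp w, supp (φ U) ⊆ U) ∧ v = w >>= φ}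

/-- The convex closure operator `cl = P μ ∘ δ ∘ η`. -/
def cl {e : Env} {X : Type u} (U : Set (e.T X)) : Set (e.T X) :=
  (fun v => v >>= id) '' dlaw (pure U)

/-- The Kleisli composite `P μ`-after-`δ`: `{u ∈ U} ↦ μ^P (P μ^T) (P δ) (P T g) U`. -/
def setBind {e : Env} {X Y : Type u} (U : Set (e.T X)) (g : X → Set (e.T Y)) : Set (e.T Y) :=
  ⋃ u ∈ U, (fun v => v >>= id) '' dlaw (g <$> u)

theorem mem_cl {e : Env} {X : Type u} {U : Set (e.T X)} {v : e.T X} :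
    v ∈ cl U ↔ ∃ w : e.T (e.T X), supp w ⊆ U ∧ v = w >>= id := by
  constructor
  · rintro ⟨_, ⟨φ, hφ, rfl⟩, rfl⟩
    refine ⟨φ U, hφ U (by rw [supp_pure]; rfl), ?_⟩
    simp only [pure_bind']
  · rintro ⟨w, hw, rfl⟩
    refine ⟨w, ⟨fun _ => w, fun V hV => ?_, by rw [pure_bind']⟩, rfl⟩
    rw [supp_pure] at hV
    rw [Set.mem_singleton_iff.1 hV]
    exact hw

theorem subset_cl {e : Env} {X : Type u} (U : Set (e.T X)) : U ⊆ cl U := fun v hv =>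
  mem_cl.2 ⟨pure v, by rw [supp_pure]; exact Set.singleton_subset_iff.2 hv, by rw [pure_bind']; rfl⟩

theorem cl_cl {e : Env} {X : Type u} (U : Set (e.T X)) : cl (cl U) = cl U := by
  refine Set.Subset.antisymm (fun v hv => ?_) (subset_cl _)
  obtain ⟨w, hw, rfl⟩ := mem_cl.1 hv
  have : ∀ v : e.T X, ∃ Φ : e.T (e.T X), v ∈ supp w → supp Φ ⊆ U ∧ v = Φ >>= id := by
    intro v
    by_cases h : v ∈ supp w
    · obtain ⟨Φ, h1, h2⟩ := mem_cl.1 (hw h)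
      exact ⟨Φ, fun _ => ⟨h1, h2⟩⟩
    · exact ⟨pure v, fun h' => (h h').elim⟩
  choose Φ hΦ using this
  refine mem_cl.2 ⟨w >>= Φ, ?_, ?_⟩
  · rw [supp_bind]
    exact Set.iUnion₂_subset fun v hv => (hΦ v hv).1
  · rw [bind_assoc']
    exact bind_congr' _ fun v hv => (hΦ v hv).2

/-- Membership in a Kleisli composite: choose an element of each convex set `g x`. -/
theorem mem_setBind {e : Env} {X Y : Type u} {U : Set (e.T X)} {g : X → Set (e.T Y)}
    (hg : ∀ x, cl (g x) = g x) {v : e.T Y} :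
    v ∈ setBind U g ↔
      ∃ u ∈ U, ∃ h : X → e.T Y, (∀ x ∈ supp u, h x ∈ g x) ∧ v = u >>= h := by
  simp only [setBind, Set.mem_iUnion, exists_prop]
  constructor
  · rintro ⟨u, hu, _, ⟨φ, hφ, rfl⟩, rfl⟩
    refine ⟨u, hu, fun x => φ (g x) >>= id, fun x hx => ?_, ?_⟩
    · rw [← hg x]
      refine mem_cl.2 ⟨_, hφ _ ?_, rfl⟩
      rw [map_eq, supp_bind]
      exact Set.mem_biUnion hx (by rw [supp_pure]; rfl)
    · simp only [map_eq, bind_assoc', pure_bind']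
  · rintro ⟨u, hu, h, hh, rfl⟩
    refine ⟨u, hu, ?_⟩
    obtain ⟨k, hk, hw⟩ := exists_kernel (u >>= fun x => (pure (g x, h x) : e.T (Set (e.T Y) × e.T Y)))
    have hs : ∀ p, p ∈ supp (u >>= fun x => (pure (g x, h x) : e.T (Set (e.T Y) × e.T Y))) ↔
        ∃ x ∈ supp u, p = (g x, h x) := by
      intro p
      simp [supp_bind, supp_pure]
    refine ⟨(g <$> u) >>= k, ⟨k, fun V hV => ?_, rfl⟩, ?_⟩
    · have hV' : ∃ x ∈ supp u, V = g x := by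
        simpa [map_eq, supp_bind, supp_pure] using hV
      obtain ⟨x, hx, rfl⟩ := hV'
      intro z hz
      obtain ⟨x', hx', h'⟩ := (hs _).1 (hk _ ⟨h x, (hs _).2 ⟨x, hx, rfl⟩⟩ z hz)
      rw [(Prod.mk.inj h').1, (Prod.mk.inj h').2]
      exact hh x' hx'
    · have := congrArg (fun w => w >>= Prod.snd) hw
      simp only [bind_assoc', pure_bind'] at this
      simp only [map_eq, bind_assoc', pure_bind']
      exact (this.trans rfl).symm

theorem cl_setBind {e : Env} {X Y : Type u} {U : Set (e.T X)} {g : X → Set (e.T Y)}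
    (hU : cl U = U) (hg : ∀ x, cl (g x) = g x) : cl (setBind U g) = setBind U g := by
  refine Set.Subset.antisymm (fun v hv => ?_) (subset_cl _)
  obtain ⟨Φ, hΦ, rfl⟩ := mem_cl.1 hv
  have h1 : ∀ v : e.T Y, ∃ (u : e.T X) (h : X → e.T Y), v ∈ supp Φ →
      u ∈ U ∧ (∀ x ∈ supp u, h x ∈ g x) ∧ v = u >>= h := by
    obtain ⟨v₀, hv₀⟩ := supp_nonempty Φ
    obtain ⟨u₀, -, h₀, -⟩ := (mem_setBind hg).1 (hΦ hv₀)
    intro v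
    by_cases h : v ∈ supp Φ
    · obtain ⟨u, hu, k, hk⟩ := (mem_setBind hg).1 (hΦ h)
      exact ⟨u, k, fun _ => ⟨hu, hk⟩⟩
    · exact ⟨u₀, h₀, fun h' => (h h').elim⟩
  choose u h hu using h1
  obtain ⟨k, hk, hw⟩ := exists_kernel
    (Φ >>= fun v => u v >>= fun x => (pure (x, h v x) : e.T (X × e.T Y)))
  have hs : ∀ p, p ∈ supp (Φ >>= fun v => u v >>= fun x => (pure (x, h v x) : e.T (X × e.T Y))) ↔
      ∃ v ∈ supp Φ, ∃ x ∈ supp (u v), p = (x, h v x) := by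
    intro p
    simp [supp_bind, supp_pure]
  refine (mem_setBind hg).2 ⟨Φ >>= u, ?_, fun x => k x >>= id, fun x hx => ?_, ?_⟩
  · rw [← hU]
    refine mem_cl.2 ⟨Φ >>= fun v => pure (u v), ?_, ?_⟩
    · rw [supp_bind]
      refine Set.iUnion₂_subset fun v hv => ?_
      rw [supp_pure]
      exact Set.singleton_subset_iff.2 (hu v hv).1
    · simp only [bind_assoc', pure_bind', id]
  · rw [← hg x]
    rw [supp_bind] at hx
    simp only [Set.mem_iUnion, exists_prop] at hx
    obtain ⟨v, hv, hx⟩ := hx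
    refine mem_cl.2 ⟨k x, fun z hz => ?_, rfl⟩
    obtain ⟨v', hv', x', hx', h'⟩ := (hs _).1 (hk x ⟨h v x, (hs _).2 ⟨v, hv, x, hx, rfl⟩⟩ z hz)
    rw [(Prod.mk.inj h').1, (Prod.mk.inj h').2]
    exact (hu v' hv').2.1 x' hx'
  · have := congrArg (fun w => w >>= Prod.snd) hw
    simp only [bind_assoc', pure_bind'] at this
    simp only [bind_assoc']
    refine Eq.trans (bind_congr' _ fun v hv => (hu v hv).2.2) (this.trans rfl)

/-- The functor part of the composite monad: the convex subsets of `T X`. -/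
@[ext]
structure PT (e : Env) (X : Type u) : Type u where
  carrier : Set (e.T X)
  convex : cl carrier = carrier

instance {e : Env} {X : Type u} : Membership (e.T X) (PT e X) := ⟨fun U v => v ∈ U.carrier⟩

instance {e : Env} {X : Type u} : LE (PT e X) := ⟨fun U V => U.carrier ⊆ V.carrier⟩

theorem cl_singleton {e : Env} {X : Type u} (v : e.T X) : cl {v} = {v} := by
  refine Set.Subset.antisymm (fun v' hv' => ?_) (subset_cl _)
  obtain ⟨w, hw, rfl⟩ := mem_cl.1 hv'
  have h : w >>= id = w >>= fun _ => v := bind_congr' _ fun x hx => hw hx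
  have h2 : (w >>= fun _ => v) = v := by
    cases e
    · exact Subtype.ext (Set.biUnion_const w.2.2 _)
    · exact Subtype.ext (PMF.bind_const _ _)
  exact h.trans h2

theorem cl_empty {e : Env} {X : Type u} : cl (∅ : Set (e.T X)) = ∅ := by
  refine Set.eq_empty_of_forall_notMem fun v hv => ?_
  obtain ⟨w, hw, -⟩ := mem_cl.1 hv
  exact (supp_nonempty w).elim fun x hx => hw hx

/-- The composite monad, with unit `η^P η^T` and multiplication `μ^P μ^T ∘ P δ`. -/
noncomputable instance (e : Env) : Monad (PT e) where
  pure x := ⟨{pure x}, cl_singleton _⟩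
  bind U g := ⟨setBind U.carrier fun x => (g x).carrier,
    cl_setBind U.convex fun x => (g x).convex⟩

/-- The join `cl (⋃ Uₙ)` of a sequence of convex sets. -/
def PT.iSup {e : Env} {X : Type u} (U : ℕ → PT e X) : PT e X :=
  ⟨cl (⋃ n, (U n).carrier), cl_cl _⟩

/-- The map `X → PT 0` into the final object of the Kleisli category. -/
def bang {e : Env} {X : Type u} (_ : X) : PT e PEmpty.{u + 1} := ⟨∅, cl_empty⟩

/-- The functor `K : Kl(T) → Kl(PT)` on a morphism. -/
def K {e : Env} {X Y : Type u} (f : X → e.T Y) (x : X) : PT e Y := ⟨cl {f x}, cl_cl _⟩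

/-! ### Linear functors and their Kleisli extensions -/

variable (A B : Type u)

/-- `H Y = B + A × Y`. -/
abbrev H (Y : Type u) : Type u := B ⊕ (A × Y)

/-- `H_X Y = X × H Y`. -/
abbrev HX (X Y : Type u) : Type u := X × H A B Y

/-- The `n`-fold iterate of `H_X`. -/
def HXn (X : Type u) : ℕ → Type u → Type u
  | 0, Y => Y
  | n + 1, Y => HXn X n (HX A B X Y)

variable {A B}

section Kleisli

variable {M : Type u → Type u} [Monad M] {X Y Z : Type u}

/-- The left strength `X × M Y → M (X × Y)`. -/
def stl (x : X) (m : M Y) : M (X × Y) := (fun y => (x, y)) <$> m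

/-- The extension of `H` to the Kleisli category of `M`: the composite of the canonical law
`H (M Z) → M (H Z)` with `H f`. -/
def H.ext (f : Y → M Z) : H A B Y → M (H A B Z)
  | .inl b => pure (.inl b)
  | .inr (a, y) => .inr <$> stl a (f y)

/-- The extension of `H_X` to the Kleisli category of `M`. -/
def HX.ext (f : Y → M Z) (p : HX A B X Y) : M (HX A B X Z) := stl p.1 (H.ext f p.2)

/-- The extension of `H_X^n` to the Kleisli category of `M`. -/
def HXn.ext : (n : ℕ) → {Y Z : Type u} → (Y → M Z) → HXn A B X n Y → M (HXn A B X n Z)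
  | 0, _, _, f => f
  | n + 1, _, _, f => HXn.ext n (HX.ext f)

/-- `c^* = (X → X × M H X → M (X × H X))`. -/
def star (c : X → M (H A B X)) (x : X) : M (HX A B X X) := stl x (c x)

end Kleisli

/-! ### Initial algebras, traces and executions -/

/-- A finite trace `a₁ … aₙ b`. -/
abbrev Trace (A B : Type u) : Type u := List A × B

/-- An execution `x₀ a₁ x₁ … aₙ xₙ b`, stored as `([(x₀, a₁), …, (xₙ₋₁, aₙ)], xₙ, b)`. -/
abbrev Exec (A B X : Type u) : Type u := List (X × A) × X × B

/-- The initial `H`-algebra `B + A × A^*B ≃ A^*B`. -/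
def traceAlg : H A B (Trace A B) ≃ Trace A B where
  toFun
    | .inl b => ([], b)
    | .inr (a, l, b) => (a :: l, b)
  invFun
    | ([], b) => .inl b
    | (a :: l, b) => .inr (a, l, b)
  left_inv := by rintro (b | ⟨a, l, b⟩) <;> rfl
  right_inv := by rintro ⟨_ | ⟨a, l⟩, b⟩ <;> rfl

/-- The initial `H_X`-algebra. -/
def execAlg {X : Type u} : HX A B X (Exec A B X) ≃ Exec A B X where
  toFun
    | (x, .inl b) => ([], x, b)
    | (x, .inr (a, l, y, b)) => ((x, a) :: l, y, b)
  invFun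
    | ([], x, b) => (x, .inl b)
    | ((x, a) :: l, y, b) => (x, .inr (a, l, y, b))
  left_inv := by rintro ⟨x, b | ⟨a, l, y, b⟩⟩ <;> rfl
  right_inv := by rintro ⟨_ | ⟨⟨x, a⟩, l⟩, y, b⟩ <;> rfl

/-- The function `f_{π₂}`, which forgets controller states. -/
def forget {X : Type u} (p : Exec A B X) : Trace A B := (p.1.map Prod.snd, p.2.2)

/-- `f_{π₂}` is the map of initial algebras induced by the projection `π₂ : H_X → H`. -/
theorem forget_execAlg {X : Type u} (p : HX A B X (Exec A B X)) :
    forget (execAlg p) = traceAlg (Sum.map id (Prod.map id forget) p.2) := by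
  rcases p with ⟨x, b | ⟨a, l, y, b⟩⟩ <;> rfl

/-- `H_X^n` on functions. -/
def HXn.map {X : Type u} : (n : ℕ) → {Y Z : Type u} → (Y → Z) → HXn A B X n Y → HXn A B X n Z
  | 0, _, _, f => f
  | n + 1, _, _, f => HXn.map n (Prod.map id (Sum.map id (Prod.map id f)))

/-- The iterated algebra structure `H_X^n I → I` on the initial algebra `I`. -/
def foldExec {X : Type u} : (n : ℕ) → HXn A B X n (Exec A B X) → Exec A B X
  | 0, p => p
  | n + 1, p => foldExec n (HXn.map n execAlg p)

/-- The coprojection `κₙ : H_X^n 0 → I` from the initial sequence. -/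
def kappa {X : Type u} (n : ℕ) (p : HXn A B X n PEmpty.{u + 1}) : Exec A B X :=
  foldExec n (HXn.map n PEmpty.elim p)

open Classical in
/-- The projection `πₙ : I → H_X^n 0` of the embedding `κₙ` in the Kleisli category of `PT`:
it inverts `κₙ` on its range and is empty elsewhere. -/
noncomputable def proj {e : Env} {X : Type u} (n : ℕ) (p : Exec A B X) :
    PT e (HXn A B X n PEmpty.{u + 1}) :=
  if h : ∃ q, kappa n q = p then pure h.choose else ⟨∅, cl_empty⟩

/-- `t` is a trace map of the coalgebra `c`: a coalgebra morphism in the Kleisli category of `PT`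
from `c` to the coalgebra given by the inverse of the initial `H`-algebra. -/
def IsTraceMap {e : Env} {X : Type u} (c : X → PT e (H A B X)) (t : X → PT e (Trace A B)) : Prop :=
  ∀ x, c x >>= H.ext t = t x >>= fun s => pure (traceAlg.symm s)

/-! ### Strategies -/

/-- The image `⋃ supp (f x)` of a morphism of the Kleisli category of `T`. -/
def Im {e : Env} {X Y : Type u} (f : X → e.T Y) : Set Y := ⋃ x, supp (f x)

/-- A strategy from `x`: a chain of morphisms `σₙ₊₁ : Im σₙ → H_X^(n+1) X` of the Kleisli category
of `T` (here `next n`), where `σ₀ : 1 → X` picks `η x` and `im n` is `Im σₙ`. -/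
structure Strategy {e : Env} {X : Type u} (c : X → PT e (H A B X)) (x : X) where
  im : ∀ n, Set (HXn A B X n X)
  next : ∀ n, im n → e.T (HXn A B X (n + 1) X)
  im_zero : im 0 = Im fun _ : PUnit.{u + 1} => (pure x : e.T X)
  im_succ : ∀ n, im (n + 1) = Im (next n)
  /-- `σₙ₊₁` extends the plays in `Im σₙ`. -/
  extends_play : ∀ n (p : im n),
    next n p >>= HXn.ext (X := X) n (fun q : HX A B X X => (pure q.1 : e.T X)) = pure p.1
  /-- `σₙ₊₁` chooses out of the successors in `c`. -/
  chooses : ∀ n (p : im n), K (next n) p ≤ HXn.ext n (star c) p.1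

namespace Strategy

variable {e : Env} {X : Type u} {c : X → PT e (H A B X)} {x : X}

/-- The composite of the morphisms `1 → Im σ₀ → ⋯ → Im σₙ`. -/
noncomputable def run (σ : Strategy c x) : (n : ℕ) → e.T (σ.im n)
  | 0 => corestrict (S := σ.im 0) (pure x : e.T X) (by
      rw [σ.im_zero]; exact Set.subset_iUnion (fun _ : PUnit.{u + 1} => supp (pure x : e.T X)) ⟨⟩)
  | n + 1 => σ.run n >>= fun p => corestrict (σ.next n p) (by
      rw [σ.im_succ]; exact Set.subset_iUnion (fun q => supp (σ.next n q)) p)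

/-- The `n`-step partial outcome, a morphism `1 → H_X^n X` of the Kleisli category of `T`. -/
noncomputable def plays (σ : Strategy c x) (n : ℕ) (_ : PUnit.{u + 1}) : e.T (HXn A B X n X) :=
  Subtype.val <$> σ.run n

/-- The cone over the final sequence with components `1 → H_X^n X → H_X^n 0`. -/
noncomputable def cone (σ : Strategy c x) (n : ℕ) : PT e (HXn A B X n PEmpty.{u + 1}) :=
  K (σ.plays n) ⟨⟩ >>= HXn.ext n bang

/-- The completed outcome: the join of the morphisms `1 → H_X^n X → H_X^n 0 → I`. -/
noncomputable def outcome (σ : Strategy c x) : PT e (Exec A B X) :=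
  PT.iSup fun n => σ.cone n >>= fun p => pure (kappa n p)

/-- The strategy forces the collection `U` of finite traces: `U` underlies a collection of
executions in its completed outcome. -/
def Forces (σ : Strategy c x) (U : e.T (Trace A B)) : Prop :=
  ∃ V ∈ σ.outcome, forget <$> V = U

end Strategy

end TwoPlayer

namespace TwoPlayer

/-! ### Monad laws -/

section MonadLaws

variable {e : Env} {I X Y Z : Type u}

/-! Elements of `T` have finite non-empty support. Hence finitely many choices from an increasing
chain of convex sets already lie in one member of it, the join of the chain is its union
(`PT.mem_iSup`), and all executions or traces in one support have a common length bound.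

A completed outcome is therefore the union of the outcomes completed after `n` steps. As the `κₙ`
are embeddings whose ranges exhaust the executions, an element of a convex set is recovered from its
projection at some finite stage, which gives `Strategy.bind_proj_iff`. Likewise the trace equation
has only one solution, the union of the iterates `traces c n` from the empty set: continuity makes
it a solution, and every unfolding consumes an action, so bounded traces are reached after finitely
many unfoldings.

The link to strategies is the parallel iteration `execs c n` for executions, which `forget` carries
to `traces c n`. The `n`-step completed outcome of a strategy lies in `execs c n`
(`Strategy.K_plays_bind_le`). Conversely, a member of `execs c N x` is peeled one layer at a time
into choices from `c` and remainders, which yields a strategy (`Stage.mem_outcome_strategy`). Since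
a play records its whole past, choices at different histories never collide. So the union of the
outcomes is the join of the `execs c n`, which is convex and maps onto the traces. -/

instance : LawfulMonad e.T :=
  LawfulMonad.mk' _ (fun v => by rw [map_eq]; exact bind_pure' v) pure_bind' bind_assoc'
    (map_const := by cases e <;> intros <;> rfl)
    (seqLeft_eq := by cases e <;> intros <;> rfl)
    (seqRight_eq := by cases e <;> intros <;> rfl)
    (bind_pure_comp := by cases e <;> intros <;> rfl)
    (bind_map := by cases e <;> intros <;> rfl)

theorem supp_finite (v : e.T X) : (supp v).Finite := by
  cases e
  · exact v.2.1
  · exact v.2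

theorem supp_map (f : X → Y) (v : e.T X) : supp (f <$> v) = f '' supp v := by
  rw [map_eq, supp_bind]
  ext y
  simp [supp_pure, eq_comm]

theorem combine_const (v : e.T X) (y : Y) : v >>= (fun _ => (pure y : e.T Y)) = pure y := by
  cases e
  · exact Subtype.ext (Set.biUnion_const v.2.2 _)
  · exact Subtype.ext (PMF.bind_const _ _)

theorem map_val_corestrict {S : Set X} (v : e.T X) (h : supp v ⊆ S) :
    Subtype.val <$> corestrict v h = v := by
  rw [map_eq]
  cases e
  · refine Subtype.ext (Set.ext fun x => ?_)
    change (x ∈ ⋃ y ∈ Subtype.val ⁻¹' v.1, {y.1}) ↔ _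
    simp only [Set.mem_iUnion, Set.mem_preimage, Set.mem_singleton_iff]
    constructor
    · rintro ⟨y, hy, rfl⟩
      exact hy
    · exact fun hx => ⟨⟨x, h hx⟩, hx, rfl⟩
  · refine Subtype.ext ?_
    change (v.1.bindOnSupport fun x hx => PMF.pure (⟨x, h hx⟩ : S)).bind
      (fun y => PMF.pure y.1) = v.1
    conv_rhs => rw [← PMF.bind_pure v.1]
    rw [← PMF.bindOnSupport_eq_bind, PMF.bindOnSupport_bindOnSupport,
      ← PMF.bindOnSupport_eq_bind]
    congr 1
    funext x hx
    rw [PMF.bindOnSupport_eq_bind, PMF.pure_bind]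

theorem corestrict_bind {S : Set X} (v : e.T X) (h : supp v ⊆ S) {f : S → e.T Y} {g : X → e.T Y}
    (hfg : ∀ x : S, x.1 ∈ supp v → f x = g x) : corestrict v h >>= f = v >>= g := by
  have hv := map_val_corestrict v h
  conv_rhs => rw [← hv, map_eq, bind_assoc']
  refine bind_congr' _ fun x hx => ?_
  rw [pure_bind']
  refine hfg x ?_
  rw [← hv, supp_map]
  exact Set.mem_image_of_mem _ hx

/-! ### The composite monad: laws, order and joins of chains -/

namespace PT

theorem mem_def {U : PT e X} {v : e.T X} : v ∈ U ↔ v ∈ U.carrier := Iff.rfl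

theorem ext_mem {U V : PT e X} (h : ∀ v, v ∈ U ↔ v ∈ V) : U = V := PT.ext (Set.ext h)

theorem le_refl (U : PT e X) : U ≤ U := fun _ h => h

theorem le_trans {U V W : PT e X} (h : U ≤ V) (h' : V ≤ W) : U ≤ W := fun _ hv => h' (h hv)

theorem le_of_eq {U V : PT e X} (h : U = V) : U ≤ V := h ▸ le_refl U

theorem le_antisymm {U V : PT e X} (h : U ≤ V) (h' : V ≤ U) : U = V :=
  ext_mem fun _ => ⟨fun hv => h hv, fun hv => h' hv⟩

/-- Convex sets are closed under `T`-combinations. -/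
theorem combine_mem (U : PT e X) (v : e.T Y) (f : Y → e.T X) (h : ∀ y ∈ supp v, f y ∈ U) :
    v >>= f ∈ U := by
  rw [mem_def, ← U.convex]
  refine mem_cl.2 ⟨f <$> v, ?_, ?_⟩
  · rw [supp_map]
    rintro _ ⟨y, hy, rfl⟩
    exact h y hy
  · simp only [map_eq, bind_assoc', pure_bind', id]

theorem mem_bind {U : PT e X} {g : X → PT e Y} {v : e.T Y} :
    v ∈ U >>= g ↔ ∃ u ∈ U, ∃ h : X → e.T Y, (∀ x ∈ supp u, h x ∈ g x) ∧ v = u >>= h :=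
  mem_setBind fun x => (g x).convex

theorem mem_pure {x : X} {v : e.T X} : v ∈ (pure x : PT e X) ↔ v = pure x := Iff.rfl

theorem mem_bind_pure {U : PT e X} {f : X → Y} {v : e.T Y} :
    v ∈ (U >>= fun x => pure (f x)) ↔ ∃ u ∈ U, f <$> u = v := by
  rw [mem_bind]
  constructor
  · rintro ⟨u, hu, h, hh, rfl⟩
    exact ⟨u, hu, by rw [map_eq]; exact (bind_congr' _ fun x hx => mem_pure.1 (hh x hx)).symm⟩
  · rintro ⟨u, hu, rfl⟩
    exact ⟨u, hu, fun x => pure (f x), fun x _ => rfl, map_eq _ _⟩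

/-- Choices from the convex sets `P x` that depend on an index besides `x` can be averaged into
choices that depend on `x` only. -/
theorem exists_average (Φ : e.T I) (u : I → e.T X) (l : I → X → e.T Y) (P : X → PT e Y)
    (hl : ∀ i ∈ supp Φ, ∀ x ∈ supp (u i), l i x ∈ P x) :
    ∃ k : X → e.T Y, (∀ x ∈ supp (Φ >>= u), k x ∈ P x) ∧
      (Φ >>= fun i => u i >>= l i) = Φ >>= u >>= k := by
  -- Condition the joint combination of the pairs `(x, l i x)` on `x`: the kernel at `x` is a
  -- combination of elements of `P x`, and convexity flattens it to one element.
  obtain ⟨k, hk, hw⟩ := exists_kernel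
    (Φ >>= fun i => u i >>= fun x => (pure (x, l i x) : e.T (X × e.T Y)))
  have hs : ∀ p, p ∈ supp (Φ >>= fun i => u i >>= fun x => (pure (x, l i x) : e.T (X × e.T Y))) ↔
      ∃ i ∈ supp Φ, ∃ x ∈ supp (u i), p = (x, l i x) := by
    intro p
    simp only [supp_bind, supp_pure, Set.mem_iUnion, Set.mem_singleton_iff, exists_prop]
  refine ⟨fun x => k x >>= id, fun x hx => ?_, ?_⟩
  · simp only [supp_bind, Set.mem_iUnion, exists_prop] at hx
    obtain ⟨i, hi, hx⟩ := hx
    refine combine_mem _ _ _ fun z hz => ?_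
    obtain ⟨j, hj, y, hy, h⟩ := (hs _).1 (hk x ⟨l i x, (hs _).2 ⟨i, hi, x, hx, rfl⟩⟩ z hz)
    rw [(Prod.mk.inj h).1, (Prod.mk.inj h).2]
    exact hl j hj y hy
  · have := congrArg (fun w => w >>= Prod.snd) hw
    simp only [bind_assoc', pure_bind'] at this
    simp only [bind_assoc']
    exact this.trans rfl

/-- Only one half of associativity needs convexity: the choices from `k y` may depend on the `x`
through which `y` was reached, whereas `U >>= g >>= k` allows one choice per `y`. -/
instance : LawfulMonad (PT e) :=
  LawfulMonad.mk' _
    (fun U => by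
      refine ext_mem fun v => mem_bind_pure.trans ?_
      simp)
    (fun x g => by
      refine ext_mem fun v => mem_bind.trans ⟨?_, fun hv => ?_⟩
      · rintro ⟨u, rfl, h, hh, rfl⟩
        rw [pure_bind']
        exact hh x (by rw [supp_pure]; rfl)
      · refine ⟨pure x, rfl, fun _ => v, fun y hy => ?_, (pure_bind' x fun _ => v).symm⟩
        rw [supp_pure] at hy
        rw [Set.mem_singleton_iff.1 hy]
        exact hv)
    (fun U g k => by
      refine ext_mem fun v => ⟨fun hv => ?_, fun hv => ?_⟩
      · obtain ⟨w, hw, l, hl, rfl⟩ := mem_bind.1 hv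
        obtain ⟨u, hu, h, hh, rfl⟩ := mem_bind.1 hw
        refine mem_bind.2 ⟨u, hu, fun x => h x >>= l, fun x hx => ?_, bind_assoc' _ _ _⟩
        refine mem_bind.2 ⟨h x, hh x hx, l, fun y hy => hl y ?_, rfl⟩
        rw [supp_bind]
        exact Set.mem_biUnion hx hy
      · obtain ⟨u, hu, h', hh', rfl⟩ := mem_bind.1 hv
        have : ∀ x, ∃ (h : e.T _) (l : _ → e.T _), x ∈ supp u →
            h ∈ g x ∧ (∀ y ∈ supp h, l y ∈ k y) ∧ h' x = h >>= l := by
          -- The support is non-empty, so some valid choice exists; it serves as the unused value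
          -- off `supp u`.
          obtain ⟨x₀, hx₀⟩ := supp_nonempty u
          obtain ⟨h₀, -, l₀, -⟩ := mem_bind.1 (hh' x₀ hx₀)
          intro x
          by_cases hx : x ∈ supp u
          · obtain ⟨h, hh, l, hl, h1⟩ := mem_bind.1 (hh' x hx)
            exact ⟨h, l, fun _ => ⟨hh, hl, h1⟩⟩
          · exact ⟨h₀, l₀, fun h => (hx h).elim⟩
        choose h l hl using this
        obtain ⟨m, hm, h1⟩ := exists_average u h l k fun x hx => (hl x hx).2.1
        refine mem_bind.2 ⟨u >>= h, mem_bind.2 ⟨u, hu, h, fun x hx => (hl x hx).1, rfl⟩, m, hm, ?_⟩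
        rw [← h1]
        exact bind_congr' _ fun x hx => (hl x hx).2.2)

/-- The empty convex set. -/
def none : PT e X := ⟨∅, cl_empty⟩

theorem not_mem_none (v : e.T X) : ¬ v ∈ (none : PT e X) := fun h => h

theorem none_le (U : PT e X) : none ≤ U := fun v hv => (not_mem_none v hv).elim

theorem none_bind (g : X → PT e Y) : none >>= g = none :=
  le_antisymm (fun _ hv => (mem_bind.1 hv).elim fun u hu => (not_mem_none u hu.1).elim) (none_le _)

/-- Supports are non-empty, so `T` of the empty type is empty. Thus `bang` is the only map into it.
-/
instance : Subsingleton (PT e PEmpty.{u + 1}) :=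
  ⟨fun _ _ => ext_mem fun v => (supp_nonempty v).elim fun x => x.elim⟩

theorem bind_mono {U V : PT e X} {g k : X → PT e Y} (h : U ≤ V) (hg : ∀ x, g x ≤ k x) :
    U >>= g ≤ V >>= k := by
  intro v hv
  obtain ⟨u, hu, l, hl, rfl⟩ := mem_bind.1 hv
  exact mem_bind.2 ⟨u, h hu, l, fun x hx => hg x (hl x hx), rfl⟩

theorem map_mono {U V : PT e X} (f : X → Y) (h : U ≤ V) : f <$> U ≤ f <$> V :=
  bind_mono h fun _ => le_refl _

theorem combine_mem_bind {S : Set X} {w : e.T S} {U : PT e X} {g : X → PT e Y} {f : S → e.T Y}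
    (hU : Subtype.val <$> w ∈ U) (hf : ∀ s ∈ supp w, f s ∈ g s) : w >>= f ∈ U >>= g := by
  classical
  -- The value off `S` is never used; `w >>= f` is merely an available element.
  refine mem_bind.2 ⟨_, hU, fun x => if h : x ∈ S then f ⟨x, h⟩ else w >>= f, ?_, ?_⟩
  · rw [supp_map]
    rintro _ ⟨s, hs, rfl⟩
    simpa using hf s hs
  · rw [map_eq, bind_assoc']
    refine bind_congr' _ fun s _ => ?_
    rw [pure_bind']
    simp

/-- A combination of elements of the union involves only finitely many of them, so they share a
stage, and that stage is convex. -/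
theorem mem_iSup {U : ℕ → PT e X} (hU : ∀ n, U n ≤ U (n + 1)) {v : e.T X} :
    v ∈ PT.iSup U ↔ ∃ n, v ∈ U n := by
  have hm : ∀ {m n}, m ≤ n → U m ≤ U n := fun h => Nat.le_induction (le_refl _)
    (fun n _ ih => le_trans ih (hU n)) _ h
  constructor
  · intro hv
    obtain ⟨w, hw, rfl⟩ := mem_cl.1 hv
    have : ∀ᶠ n in Filter.atTop, ∀ z ∈ supp w, z ∈ U n := by
      rw [Filter.eventually_all_finite (supp_finite w)]
      intro z hz
      obtain ⟨n, hn⟩ := Set.mem_iUnion.1 (hw hz)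
      exact Filter.eventually_atTop.2 ⟨n, fun m h => hm h hn⟩
    obtain ⟨n, hn⟩ := this.exists
    exact ⟨n, combine_mem _ _ _ hn⟩
  · rintro ⟨n, hn⟩
    exact subset_cl _ (Set.mem_iUnion.2 ⟨n, hn⟩)

end PT

theorem mem_K {f : X → e.T Y} {x : X} {v : e.T Y} : v ∈ K f x ↔ v = f x := by
  change v ∈ cl {f x} ↔ _
  rw [cl_singleton]
  rfl

theorem K_bind_pure (f : X → e.T Y) (g : Y → Z) (x : X) :
    (K f x >>= fun y => pure (g y)) = K (fun x => g <$> f x) x := by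
  refine PT.ext_mem fun v => ?_
  rw [PT.mem_bind_pure, mem_K]
  constructor
  · rintro ⟨u, hu, rfl⟩
    rw [mem_K.1 hu]
  · exact fun h => ⟨_, mem_K.2 rfl, h.symm⟩

end MonadLaws

/-! ### Functoriality of the Kleisli extensions -/

section Functoriality

variable {A B X Y Z W : Type u}

section Lawful

variable {M : Type u → Type u} [Monad M] [LawfulMonad M]

theorem H.ext_pure (f : Y → Z) (p : H A B Y) :
    H.ext (fun y => (pure (f y) : M Z)) p = pure (Sum.map id (Prod.map id f) p) := by
  rcases p with b | ⟨a, y⟩ <;> simp [H.ext, stl]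

theorem H.ext_comp (f : Y → M Z) (g : Z → M W) (p : H A B Y) :
    H.ext f p >>= H.ext g = H.ext (fun y => f y >>= g) p := by
  rcases p with b | ⟨a, y⟩ <;> simp [H.ext, stl]

theorem HX.ext_pure (f : Y → Z) (p : HX A B X Y) :
    HX.ext (fun y => (pure (f y) : M Z)) p =
      pure (Prod.map id (Sum.map id (Prod.map id f)) p) := by
  simp [HX.ext, stl, H.ext_pure, Prod.map]

theorem HX.ext_comp (f : Y → M Z) (g : Z → M W) (p : HX A B X Y) :
    HX.ext f p >>= HX.ext g = HX.ext (fun y => f y >>= g) p := by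
  simp [HX.ext, stl, ← H.ext_comp]

theorem HXn.ext_pure (n : ℕ) (f : Y → Z) (p : HXn A B X n Y) :
    HXn.ext n (fun y => (pure (f y) : M Z)) p = pure (HXn.map n f p) := by
  induction n generalizing Y Z with
  | zero => rfl
  | succ n ih =>
    change HXn.ext n (HX.ext _) p = _
    rw [funext (HX.ext_pure (M := M) f)]
    exact ih _ p

theorem HXn.ext_comp (n : ℕ) (f : Y → M Z) (g : Z → M W) (p : HXn A B X n Y) :
    HXn.ext n f p >>= HXn.ext n g = HXn.ext n (fun y => f y >>= g) p := by
  induction n generalizing Y Z W with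
  | zero => rfl
  | succ n ih =>
    exact (ih (HX.ext f) (HX.ext g) p).trans
      (congrArg (fun k => HXn.ext n k p) (funext (HX.ext_comp f g)))

theorem HXn.ext_bind_map (n : ℕ) (f : Y → M Z) (g : Z → W) (p : HXn A B X n Y) :
    (HXn.ext n f p >>= fun q => pure (HXn.map n g q)) =
      HXn.ext n (fun y => f y >>= fun z => pure (g z)) p := by
  rw [← HXn.ext_comp, funext (HXn.ext_pure n g)]

theorem HXn.ext_map (n : ℕ) (f : Y → Z) (g : Z → M W) (p : HXn A B X n Y) :
    HXn.ext n g (HXn.map n f p) = HXn.ext n (fun y => g (f y)) p := by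
  have := HXn.ext_comp n (fun y => (pure (f y) : M Z)) g p
  rw [HXn.ext_pure, pure_bind] at this
  simpa using this

end Lawful

theorem HXn.map_comp (n : ℕ) (f : Y → Z) (g : Z → W) (p : HXn A B X n Y) :
    HXn.map n g (HXn.map n f p) = HXn.map n (fun y => g (f y)) p := by
  induction n generalizing Y Z W with
  | zero => rfl
  | succ n ih =>
    refine (ih _ _ p).trans ?_
    change _ = HXn.map n _ p
    congr 1
    funext q
    rcases q with ⟨x, b | ⟨a, y⟩⟩ <;> rfl

theorem HXn.map_injective (n : ℕ) {f : Y → Z} (hf : Function.Injective f) :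
    Function.Injective (HXn.map (A := A) (B := B) (X := X) n f) := by
  induction n generalizing Y Z with
  | zero => exact hf
  | succ n ih =>
    exact ih (Function.injective_id.prodMap
      (Function.Injective.sumMap Function.injective_id (Function.injective_id.prodMap hf)))

variable {e : Env}

theorem H.ext_mono {f g : Y → PT e Z} (h : ∀ y, f y ≤ g y) (p : H A B Y) :
    H.ext f p ≤ H.ext g p := by
  rcases p with b | ⟨a, y⟩
  · exact PT.le_refl _
  · exact PT.map_mono _ (PT.map_mono _ (h y))

theorem HX.ext_mono {f g : Y → PT e Z} (h : ∀ y, f y ≤ g y) (p : HX A B X Y) :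
    HX.ext f p ≤ HX.ext g p :=
  PT.map_mono _ (H.ext_mono h p.2)

theorem HXn.ext_mono (n : ℕ) {f g : Y → PT e Z} (h : ∀ y, f y ≤ g y) (p : HXn A B X n Y) :
    HXn.ext n f p ≤ HXn.ext n g p := by
  induction n generalizing Y Z with
  | zero => exact h p
  | succ n ih => exact ih (HX.ext_mono h) p

/-- If every element of `f y` lies over `y` along `g`, then every element of the extension of `f`
at `p` lies over `p`. -/
theorem HXn.ext_section (n : ℕ) {f : Y → PT e Z} {g : Z → Y}
    (h : ∀ y, ∀ v ∈ f y, g <$> v = pure y) (p : HXn A B X n Y) :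
    ∀ v ∈ HXn.ext n f p, HXn.map n g <$> v = pure p := by
  induction n generalizing Y Z with
  | zero => exact h p
  | succ n ih =>
    refine ih ?_ p
    rintro ⟨x, b | ⟨a, y⟩⟩ v hv
    · obtain ⟨w, hw, rfl⟩ := PT.mem_bind_pure.1 hv
      rw [PT.mem_pure.1 hw]
      simp
    · obtain ⟨v₁, hv₁, rfl⟩ := PT.mem_bind_pure.1 hv
      obtain ⟨v₂, hv₂, rfl⟩ := PT.mem_bind_pure.1 hv₁
      obtain ⟨w, hw, rfl⟩ := PT.mem_bind_pure.1 hv₂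
      have := congrArg (fun v => (fun y => (x, (Sum.inr (a, y) : H A B Y))) <$> v) (h y w hw)
      simpa using this

end Functoriality

/-! ### The initial sequence -/

section InitialSequence

variable {e : Env} {A B X Y : Type u}

theorem foldExec_injective (n : ℕ) : Function.Injective (foldExec (A := A) (B := B) (X := X) n) := by
  induction n with
  | zero => exact Function.injective_id
  | succ n ih => exact ih.comp (HXn.map_injective n execAlg.injective)

theorem kappa_injective (n : ℕ) : Function.Injective (kappa (A := A) (B := B) (X := X) n) :=
  (foldExec_injective n).comp (HXn.map_injective n fun p => p.elim)

/-- The comparison `H_X (H_X^n Y) → H_X^(n+1) Y`. -/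
def HXn.cons : (n : ℕ) → {Y : Type u} → HX A B X (HXn A B X n Y) → HXn A B X (n + 1) Y
  | 0, _, p => p
  | n + 1, _, p => HXn.cons n p

theorem HXn.map_cons (n : ℕ) {Z : Type u} (f : Y → Z) (p : HX A B X (HXn A B X n Y)) :
    HXn.map (n + 1) f (HXn.cons n p) =
      HXn.cons n (Prod.map id (Sum.map id (Prod.map id (HXn.map n f))) p) := by
  induction n generalizing Y Z with
  | zero => rfl
  | succ n ih => exact ih _ p

theorem foldExec_cons (n : ℕ) (p : HX A B X (HXn A B X n (Exec A B X))) :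
    foldExec (n + 1) (HXn.cons n p) =
      execAlg (Prod.map id (Sum.map id (Prod.map id (foldExec n))) p) := by
  induction n with
  | zero => rcases p with ⟨x, b | ⟨a, y⟩⟩ <;> rfl
  | succ n ih =>
    refine (congrArg (foldExec (n + 1)) (HXn.map_cons n execAlg p)).trans ((ih _).trans ?_)
    rcases p with ⟨x, b | ⟨a, y⟩⟩ <;> rfl

/-- `HXn` adds its layers innermost. This is the recursion on the outermost layer, which follows the
list of an execution in `exists_kappa_eq`. -/
theorem kappa_cons (n : ℕ) (p : HX A B X (HXn A B X n PEmpty.{u + 1})) :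
    kappa (n + 1) (HXn.cons n p) =
      execAlg (Prod.map id (Sum.map id (Prod.map id (kappa n))) p) := by
  rw [kappa, HXn.map_cons, foldExec_cons]
  rcases p with ⟨x, b | ⟨a, y⟩⟩ <;> rfl

/-- An execution with `l` actions is reached in the initial sequence at every stage beyond `l`. -/
theorem exists_kappa_eq (p : Exec A B X) (n : ℕ) (hn : p.1.length < n) :
    ∃ q, kappa n q = p := by
  obtain ⟨l, y, b⟩ := p
  induction l generalizing n with
  | nil =>
    obtain ⟨n, rfl⟩ := Nat.exists_eq_succ_of_ne_zero (Nat.ne_of_gt hn)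
    exact ⟨HXn.cons n (y, .inl b), kappa_cons _ _⟩
  | cons xa l ih =>
    obtain ⟨n, rfl⟩ := Nat.exists_eq_succ_of_ne_zero (Nat.ne_of_gt (Nat.zero_lt_of_lt hn))
    obtain ⟨q, hq⟩ := ih n (by simpa using hn)
    exact ⟨HXn.cons n (xa.1, .inr (xa.2, q)), by simp [kappa_cons, hq, execAlg]⟩

theorem proj_kappa (n : ℕ) (q : HXn A B X n PEmpty.{u + 1}) :
    proj (e := e) n (kappa n q) = pure q := by
  have h : ∃ q', kappa n q' = kappa n q := ⟨q, rfl⟩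
  rw [proj, dif_pos h, kappa_injective n h.choose_spec]

theorem proj_eq_none {n : ℕ} {p : Exec A B X} (h : ¬ ∃ q, kappa n q = p) :
    proj (e := e) n p = PT.none := dif_neg h

theorem proj_bind_kappa_le (n : ℕ) (p : Exec A B X) :
    (proj (e := e) n p >>= fun q => pure (kappa n q)) ≤ pure p := by
  by_cases h : ∃ q, kappa n q = p
  · obtain ⟨q, rfl⟩ := h
    rw [proj_kappa, pure_bind]
    exact PT.le_refl _
  · rw [proj_eq_none h, PT.none_bind]
    exact PT.none_le _

/-- Any map out of the empty type becomes `PT.none` after `bang`. This turns the cone to the final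
sequence into iteration from the empty set. -/
theorem ext_bang_bind_kappa (n : ℕ) (p : HXn A B X n Y) :
    (HXn.ext n (bang (e := e)) p >>= fun q => pure (kappa n q)) =
      HXn.ext n (fun _ => PT.none) p >>= fun q => pure (foldExec n q) := by
  have h : (fun _ : Y => (PT.none : PT e (Exec A B X))) =
      fun y => bang (e := e) y >>= fun z => pure (PEmpty.elim z) :=
    funext fun _ => (PT.none_bind _).symm
  rw [h, ← HXn.ext_bind_map, bind_assoc]
  simp only [pure_bind]
  rfl

theorem kappa_succ (n : ℕ) (q : HXn A B X n (HX A B X PEmpty.{u + 1})) :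
    kappa (n + 1) q = foldExec n (HXn.map n
      (fun p => execAlg (Prod.map id (Sum.map id (Prod.map id PEmpty.elim)) p)) q) :=
  congrArg (foldExec n) (HXn.map_comp n _ _ q)

theorem ext_bang_bind_kappa_le (n : ℕ) (q : HXn A B X n (HX A B X PEmpty.{u + 1})) :
    (HXn.ext n (bang (e := e)) q >>= fun q => pure (kappa n q)) ≤ pure (kappa (n + 1) q) := by
  rw [ext_bang_bind_kappa, kappa_succ]
  refine PT.le_trans ?_ (PT.le_of_eq ((pure_bind _ fun r => pure (foldExec n r))))
  rw [← HXn.ext_pure]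
  exact PT.bind_mono (HXn.ext_mono n (fun _ => PT.none_le _) q) fun _ => PT.le_refl _

theorem kappa_succ_map_elim (n : ℕ) (q : HXn A B X n PEmpty.{u + 1}) :
    kappa (n + 1) (HXn.map n PEmpty.elim q) = kappa n q := by
  rw [kappa_succ, HXn.map_comp, kappa]
  congr 2
  funext z
  exact z.elim

theorem ext_bang_map_elim (n : ℕ) (q : HXn A B X n PEmpty.{u + 1}) :
    HXn.ext n (bang (e := e))
      (HXn.map n (PEmpty.elim : PEmpty.{u + 1} → HX A B X PEmpty.{u + 1}) q) = pure q := by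
  rw [HXn.ext_map]
  have h : (fun y : PEmpty.{u + 1} => bang (e := e) (PEmpty.elim y : HX A B X PEmpty.{u + 1})) =
      fun y => pure (id y) := funext fun y => y.elim
  rw [h, HXn.ext_pure]
  congr 1
  refine kappa_injective n ?_
  rw [kappa, HXn.map_comp]
  rfl

theorem proj_succ_bind (n : ℕ) (p : Exec A B X) :
    ((proj (e := e) (n + 1) p : PT e (HXn A B X n (HX A B X PEmpty.{u + 1}))) >>=
      HXn.ext n bang) = proj n p := by
  have hk : ∀ q : HXn A B X n (HX A B X PEmpty.{u + 1}), kappa (n + 1) q = p →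
      ((proj (e := e) (n + 1) p : PT e (HXn A B X n (HX A B X PEmpty.{u + 1}))) >>=
        HXn.ext n bang) = HXn.ext n bang q := by
    rintro q rfl
    exact (congrArg (· >>= HXn.ext n bang) (proj_kappa (n + 1) q)).trans (pure_bind _ _)
  by_cases h : ∃ q, kappa n q = p
  · obtain ⟨q, rfl⟩ := h
    rw [hk _ (kappa_succ_map_elim n q), ext_bang_map_elim, proj_kappa]
  · rw [proj_eq_none h]
    by_cases h' : ∃ q, kappa (n + 1) q = p
    · obtain ⟨q, hq⟩ := h'
      rw [hk q hq]
      -- Truncation followed by `kappa n` can only return `p`, so a surviving element would put `p`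
      -- in the range of `kappa n`.
      refine PT.le_antisymm (fun v hv => (h ?_).elim) (PT.none_le _)
      have h1 := ext_bang_bind_kappa_le n q (PT.mem_bind_pure.2 ⟨v, hv, rfl⟩)
      obtain ⟨z, hz⟩ := supp_nonempty v
      have h2 : kappa n z ∈ supp (kappa n <$> v) := by
        rw [supp_map]
        exact Set.mem_image_of_mem _ hz
      rw [PT.mem_pure.1 h1, supp_pure, hq] at h2
      exact ⟨z, h2⟩
    · exact (congrArg (· >>= HXn.ext n bang) (proj_eq_none (n := n + 1) h')).trans (PT.none_bind _)

end InitialSequence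

/-! ### Completed outcomes -/

section Outcome

variable {e : Env} {A B X : Type u} {c : X → PT e (H A B X)} {x : X}

namespace Strategy

theorem plays_succ (σ : Strategy c x) (n : ℕ) : σ.plays (n + 1) ⟨⟩ = σ.run n >>= σ.next n := by
  change Subtype.val <$> (σ.run n >>= _) = _
  rw [map_bind]
  exact bind_congr' _ fun p _ => map_val_corestrict _ _

theorem map_fst_plays_succ (σ : Strategy c x) (n : ℕ) :
    HXn.map n Prod.fst <$> (σ.plays (n + 1) ⟨⟩ : e.T (HXn A B X n (HX A B X X))) =
      σ.plays n ⟨⟩ := by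
  have key : ∀ f : σ.im n → e.T (HXn A B X n (HX A B X X)),
      (∀ p, f p >>= HXn.ext n (fun q => pure q.1) = pure p.1) →
        HXn.map n Prod.fst <$> (σ.run n >>= f) = σ.plays n ⟨⟩ := fun f hf => by
    rw [map_bind, plays, map_eq]
    refine bind_congr' _ fun p _ => ?_
    rw [← hf p, map_eq, funext (HXn.ext_pure n Prod.fst)]
  exact (congrArg (HXn.map n Prod.fst <$> ·) (σ.plays_succ n)).trans
    (key (σ.next n) (σ.extends_play n))

theorem cone_succ_bind (σ : Strategy c x) (n : ℕ) :
    ((σ.cone (n + 1) : PT e (HXn A B X n (HX A B X PEmpty.{u + 1}))) >>= HXn.ext n bang) =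
      σ.cone n := by
  -- Finality: discarding after a new layer agrees with forgetting that layer and then discarding.
  have h : (fun q : HX A B X X => HX.ext (bang (e := e)) q >>= bang) =
      fun q => pure q.1 >>= bang := Subsingleton.elim _ _
  have key : ∀ f : PUnit.{u + 1} → e.T (HXn A B X n (HX A B X X)),
      (∀ u, HXn.map n Prod.fst <$> f u = σ.plays n u) →
        K f ⟨⟩ >>= HXn.ext n (HX.ext bang) >>= HXn.ext n bang = σ.cone n := fun f hf => by
    rw [bind_assoc, funext (HXn.ext_comp n (HX.ext bang) bang), h,
      ← funext (HXn.ext_comp n (fun q : HX A B X X => (pure q.1 : PT e X)) bang), ← bind_assoc,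
      funext (HXn.ext_pure n Prod.fst), K_bind_pure, funext hf]
    rfl
  exact key (σ.plays (n + 1)) fun _ => σ.map_fst_plays_succ n

/-- The executions that are complete after `n` steps. -/
noncomputable def completed (σ : Strategy c x) (n : ℕ) : PT e (Exec A B X) :=
  σ.cone n >>= fun p => pure (kappa n p)

theorem completed_le_succ (σ : Strategy c x) (n : ℕ) : σ.completed n ≤ σ.completed (n + 1) := by
  rw [completed, ← cone_succ_bind]
  exact PT.le_trans (PT.le_of_eq (bind_assoc _ _ _))
    (PT.bind_mono (PT.le_refl _) (ext_bang_bind_kappa_le n))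

theorem completed_mono (σ : Strategy c x) {m n : ℕ} (h : m ≤ n) :
    σ.completed m ≤ σ.completed n :=
  Nat.le_induction (PT.le_refl _) (fun n _ ih => PT.le_trans ih (σ.completed_le_succ n)) _ h

theorem mem_outcome (σ : Strategy c x) {v : e.T (Exec A B X)} :
    v ∈ σ.outcome ↔ ∃ n, v ∈ σ.completed n :=
  PT.mem_iSup σ.completed_le_succ

theorem completed_bind_proj (σ : Strategy c x) {m n : ℕ} (h : m ≤ n) :
    σ.completed n >>= proj m = σ.cone m := by
  obtain ⟨k, rfl⟩ := Nat.exists_eq_add_of_le h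
  have hp : ∀ n, σ.completed n >>= proj n = σ.cone n := fun n => by
    rw [completed, bind_assoc]
    simp only [pure_bind, proj_kappa, bind_pure]
  have hs : ∀ (U : PT e (Exec A B X)) (n : ℕ), U >>= proj n =
      (U >>= proj (n + 1) : PT e (HXn A B X n (HX A B X PEmpty.{u + 1}))) >>= HXn.ext n bang :=
    fun U n => by rw [← funext (proj_succ_bind n)]; exact (bind_assoc _ _ _).symm
  have hd : ∀ k m, σ.completed (m + k) >>= proj m = σ.cone m := by
    intro k
    induction k with
    | zero => exact hp
    | succ k ih =>
      intro m
      -- Projecting to `m + 1` before `m` shortens the gap `k` by one.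
      rw [hs, ← cone_succ_bind]
      congr 1
      rw [← Nat.succ_add_eq_add_succ]
      exact ih (m + 1)
  exact hd k m

/-- `proj n` followed by `kappa n` is below the identity, and acts as the identity on any `v` whose
support lies in the range of `kappa n`. By finiteness of supports, every `v` is of this kind for
large `n`. -/
theorem bind_proj_iff (σ : Strategy c x) (m : PT e (Exec A B X)) :
    (∀ n, m >>= proj n = σ.cone n) ↔ m = σ.outcome := by
  constructor
  · intro h
    refine PT.ext_mem fun v => Iff.trans ⟨fun hv => ?_, ?_⟩ σ.mem_outcome.symm
    · have : ∀ᶠ n in Filter.atTop, ∀ p ∈ supp v, ∃ q, kappa n q = p := by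
        rw [Filter.eventually_all_finite (supp_finite v)]
        exact fun p _ => Filter.eventually_atTop.2
          ⟨p.1.length + 1, fun n hn => exists_kappa_eq p n hn⟩
      obtain ⟨n, hn⟩ := this.exists
      refine ⟨n, ?_⟩
      rw [completed, ← h n, bind_assoc]
      refine PT.mem_bind.2 ⟨v, hv, pure, fun p hp => ?_, (bind_pure' v).symm⟩
      obtain ⟨q, rfl⟩ := hn p hp
      rw [proj_kappa, pure_bind]
      rfl
    · rintro ⟨n, hn⟩
      rw [completed, ← h n, bind_assoc] at hn
      have := PT.bind_mono (PT.le_refl m) (proj_bind_kappa_le n) hn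
      rwa [bind_pure] at this
  · rintro rfl n
    refine PT.le_antisymm (fun v hv => ?_) ?_
    · obtain ⟨w, hw, l, hl, rfl⟩ := PT.mem_bind.1 hv
      obtain ⟨k, hk⟩ := σ.mem_outcome.1 hw
      -- Stage `max n k` contains `w` and still projects to the cone at `n`.
      rw [← σ.completed_bind_proj (le_max_left n k)]
      exact PT.mem_bind.2 ⟨w, σ.completed_mono (le_max_right n k) hk, l, hl, rfl⟩
    · rw [← σ.completed_bind_proj le_rfl]
      exact PT.bind_mono (fun v hv => σ.mem_outcome.2 ⟨n, hv⟩) fun _ => PT.le_refl _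

end Strategy

end Outcome

/-! ### The executions of a coalgebra -/

section Executions

variable {e : Env} {A B X : Type u}

/-- One unfolding of the recursive equation for sets of executions. -/
noncomputable def execStep (c : X → PT e (H A B X)) (g : X → PT e (Exec A B X)) (x : X) :
    PT e (Exec A B X) :=
  star c x >>= HX.ext g >>= fun q => pure (execAlg q)

/-- The executions of `c` with fewer than `n` actions, as convex sets. -/
noncomputable def execs (c : X → PT e (H A B X)) (n : ℕ) : X → PT e (Exec A B X) :=
  (execStep c)^[n] fun _ => PT.none

theorem execStep_mono (c : X → PT e (H A B X)) {f g : X → PT e (Exec A B X)}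
    (h : ∀ x, f x ≤ g x) (x : X) : execStep c f x ≤ execStep c g x :=
  PT.bind_mono (PT.bind_mono (PT.le_refl _) (HX.ext_mono h)) fun _ => PT.le_refl _

theorem execs_succ (c : X → PT e (H A B X)) (n : ℕ) :
    execs c (n + 1) = execStep c (execs c n) :=
  Function.iterate_succ_apply' _ _ _

theorem execs_le_succ (c : X → PT e (H A B X)) (n : ℕ) (x : X) :
    execs c n x ≤ execs c (n + 1) x := by
  induction n generalizing x with
  | zero => exact PT.none_le _
  | succ n ih =>
    rw [execs_succ, execs_succ c (n + 1)]
    exact execStep_mono c ih x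

/-- The truncated `n - 1` is harmless at `0`, where the left side is empty. Strategies need this
case after all plays have ended. -/
theorem execs_le_execStep (c : X → PT e (H A B X)) (n : ℕ) (x : X) :
    execs c n x ≤ execStep c (execs c (n - 1)) x := by
  cases n with
  | zero => exact PT.none_le _
  | succ n => exact PT.le_of_eq (congrFun (execs_succ c n) x)

theorem HXn.ext_execStep (c : X → PT e (H A B X)) (g : X → PT e (Exec A B X)) (n : ℕ)
    (p : HXn A B X n X) :
    HXn.ext n (execStep c g) p =
      HXn.ext n (star c) p >>= HXn.ext n (HX.ext g) >>= fun q => pure (HXn.map n execAlg q) := by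
  rw [HXn.ext_comp, HXn.ext_bind_map]
  rfl

namespace Strategy

variable {c : X → PT e (H A B X)} {x : X}

theorem K_plays_succ_le (σ : Strategy c x) (n : ℕ) :
    (K (σ.plays (n + 1)) ⟨⟩ : PT e (HXn A B X n (HX A B X X))) ≤
      K (σ.plays n) ⟨⟩ >>= HXn.ext n (star c) := by
  intro v hv
  rw [mem_K.1 hv]
  change σ.plays (n + 1) ⟨⟩ ∈ _
  rw [plays_succ]
  exact PT.combine_mem_bind (mem_K.2 rfl) fun p _ => σ.chooses n p (mem_K.2 rfl)

/-- The last step of the strategy chooses from `star c` and is absorbed into `execStep c g`; hence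
the induction over all `g`. The case of interest is `g` empty. -/
theorem K_plays_bind_le (σ : Strategy c x) (n : ℕ) (g : X → PT e (Exec A B X)) :
    (K (σ.plays n) ⟨⟩ >>= HXn.ext n g >>= fun q => pure (foldExec n q)) ≤
      (execStep c)^[n] g x := by
  induction n generalizing g with
  | zero =>
    have h : σ.plays 0 ⟨⟩ = pure x := map_val_corestrict _ _
    have hK : K (σ.plays 0) ⟨⟩ = pure x := PT.ext_mem fun v => by
      rw [mem_K, h]
      rfl
    rw [hK]
    exact PT.le_of_eq ((bind_pure _).trans (pure_bind x g))
  | succ n ih =>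
    refine PT.le_trans ?_ (ih (execStep c g))
    rw [funext (HXn.ext_execStep c g n)]
    refine PT.le_trans (PT.bind_mono (PT.bind_mono (σ.K_plays_succ_le n)
      fun _ => PT.le_refl _) fun _ => PT.le_refl _) (PT.le_of_eq ?_)
    change K (σ.plays n) ⟨⟩ >>= HXn.ext n (star c) >>= HXn.ext n (HX.ext g) >>=
      (fun q => pure (foldExec n (HXn.map n execAlg q))) = _
    simp only [bind_assoc, pure_bind]

theorem outcome_subset_execs (σ : Strategy c x) {v : e.T (Exec A B X)} (hv : v ∈ σ.outcome) :
    ∃ n, v ∈ execs c n x := by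
  obtain ⟨n, hn⟩ := σ.mem_outcome.1 hv
  refine ⟨n, σ.K_plays_bind_le n (fun _ => PT.none) ?_⟩
  rw [completed, cone, bind_assoc, funext (ext_bang_bind_kappa n), ← bind_assoc] at hn
  exact hn

end Strategy

/-! ### Strategies reaching a given collection of executions -/

theorem exists_step (c : X → PT e (H A B X)) (k n : ℕ) (p : HXn A B X n X)
    (r : e.T (HXn A B X n (Exec A B X))) (hr : r ∈ HXn.ext n (execs c k) p) :
    ∃ (s : e.T (HXn A B X n (HX A B X X)))
      (h : HXn A B X n (HX A B X X) → e.T (HXn A B X n (HX A B X (Exec A B X)))),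
      s ∈ HXn.ext n (star c) p ∧
      (∀ q ∈ supp s, h q ∈ HXn.ext n (HX.ext (execs c (k - 1))) q) ∧
      HXn.map n execAlg <$> (s >>= h) = r := by
  have h1 := HXn.ext_mono n (execs_le_execStep c k) p hr
  rw [HXn.ext_execStep] at h1
  obtain ⟨w, hw, h2⟩ := PT.mem_bind_pure.1 h1
  obtain ⟨s, hs, h, hh, rfl⟩ := PT.mem_bind.1 hw
  exact ⟨s, h, hs, hh, h2⟩

/-- A stage of the construction of a strategy that leads to a given collection of executions: the
plays reached after `n` steps and the way in which each of them is to be continued. -/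
structure Stage (c : X → PT e (H A B X)) (N n : ℕ) where
  im : Set (HXn A B X n X)
  rest : im → e.T (HXn A B X n (Exec A B X))
  -- From `n = N` on the budget `N - n` is `0`, and membership forces `p` to be a finished play.
  mem : ∀ p, rest p ∈ HXn.ext n (execs c (N - n)) p.1

namespace Stage

variable {c : X → PT e (H A B X)} {N n : ℕ}

/-- The choice of a continued play. -/
noncomputable def choice (S : Stage c N n) (p : S.im) : e.T (HXn A B X n (HX A B X X)) :=
  (exists_step c _ n p.1 _ (S.mem p)).choose

/-- The way in which the chosen continuations are to be continued. -/
noncomputable def choiceRest (S : Stage c N n) (p : S.im) :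
    HXn A B X n (HX A B X X) → e.T (HXn A B X n (HX A B X (Exec A B X))) :=
  (exists_step c _ n p.1 _ (S.mem p)).choose_spec.choose

theorem choice_mem (S : Stage c N n) (p : S.im) : S.choice p ∈ HXn.ext n (star c) p.1 :=
  (exists_step c _ n p.1 _ (S.mem p)).choose_spec.choose_spec.1

theorem choiceRest_mem (S : Stage c N n) (p : S.im) : ∀ q ∈ supp (S.choice p),
    S.choiceRest p q ∈ HXn.ext n (HX.ext (execs c (N - n - 1))) q :=
  (exists_step c _ n p.1 _ (S.mem p)).choose_spec.choose_spec.2.1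

theorem map_choice_bind (S : Stage c N n) (p : S.im) :
    HXn.map n execAlg <$> (S.choice p >>= S.choiceRest p) = S.rest p :=
  (exists_step c _ n p.1 _ (S.mem p)).choose_spec.choose_spec.2.2

/-- `star c` records the state it leaves, and a combination of equal values is that value. -/
theorem map_fst_choice (S : Stage c N n) (p : S.im) :
    HXn.map n Prod.fst <$> S.choice p = pure p.1 := by
  refine HXn.ext_section n (fun x v hv => ?_) p.1 _ (S.choice_mem p)
  obtain ⟨w, -, rfl⟩ := PT.mem_bind_pure.1 hv
  rw [map_eq, map_eq, bind_assoc']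
  simp only [pure_bind']
  exact combine_const w x

theorem map_fst_eq (S : Stage c N n) (p : S.im) {q : HXn A B X n (HX A B X X)}
    (hq : q ∈ supp (S.choice p)) : HXn.map n Prod.fst q = p.1 := by
  have := Set.mem_image_of_mem (HXn.map n Prod.fst) hq
  rwa [← supp_map, map_fst_choice, supp_pure] at this

/-- A continued play determines its predecessor, so choices at different plays have disjoint
supports. Remainders can then be assigned in `Stage.succ` without averaging. -/
theorem exists_of_mem_Im (S : Stage c N n) {q : HXn A B X n (HX A B X X)}
    (hq : q ∈ Im S.choice) :
    ∃ h : HXn.map n Prod.fst q ∈ S.im, q ∈ supp (S.choice ⟨_, h⟩) := by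
  obtain ⟨p, hp⟩ := Set.mem_iUnion.1 hq
  have h := S.map_fst_eq p hp
  exact ⟨h ▸ p.2, by simpa only [h] using hp⟩

/-- The next stage. -/
noncomputable def succ (S : Stage c N n) : Stage c N (n + 1) where
  im := Im S.choice
  rest q := S.choiceRest ⟨_, (S.exists_of_mem_Im q.2).choose⟩ q.1
  mem q := S.choiceRest_mem _ _ (S.exists_of_mem_Im q.2).choose_spec

theorem succ_rest (S : Stage c N n) (p : S.im) {q : S.succ.im} (hq : q.1 ∈ supp (S.choice p)) :
    S.succ.rest q = S.choiceRest p q.1 := by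
  have h : (⟨_, (S.exists_of_mem_Im q.2).choose⟩ : S.im) = p := Subtype.ext (S.map_fst_eq p hq)
  exact congrArg (fun p => S.choiceRest p q.1) h

/-- The stages that lead from a state to a given collection of executions. -/
noncomputable def iterate {x : X} {V : e.T (Exec A B X)} (hV : V ∈ execs c N x) :
    (n : ℕ) → Stage c N n
  | 0 =>
    { im := Im fun _ : PUnit.{u + 1} => (pure x : e.T X)
      rest := fun _ => V
      mem := by
        rintro ⟨p, hp⟩
        obtain ⟨_, hp'⟩ := Set.mem_iUnion.1 hp
        have hx : p = x := ((supp_pure (e := e) x).subset hp' :)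
        exact hx ▸ hV }
  | n + 1 => (iterate hV n).succ

/-- The strategy that leads to a given collection of executions. -/
noncomputable def strategy {x : X} {V : e.T (Exec A B X)} (hV : V ∈ execs c N x) :
    Strategy c x where
  im n := (iterate hV n).im
  next n := (iterate hV n).choice
  im_zero := rfl
  im_succ _ := rfl
  extends_play n p := by
    rw [funext (HXn.ext_pure n Prod.fst), ← map_fst_choice, map_eq]
    rfl
  chooses n p := by
    intro v hv
    rw [mem_K.1 hv]
    exact choice_mem _ p

/-- The invariant of the construction: playing `n` steps and then attaching the remainders always
reassembles `V`. -/
theorem foldExec_run_bind {x : X} {V : e.T (Exec A B X)} (hV : V ∈ execs c N x) (n : ℕ) :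
    foldExec n <$> ((strategy hV).run n >>= (iterate hV n).rest) = V := by
  induction n with
  | zero =>
    refine (id_map _).trans ?_
    change (strategy hV).run 0 >>= (fun _ => V) = V
    exact (corestrict_bind _ _ (g := fun _ => V) fun _ _ => rfl).trans (pure_bind' _ _)
  | succ n ih =>
    refine Eq.trans ?_ ih
    have h : (strategy hV).run (n + 1) >>= (iterate hV (n + 1)).rest =
        (strategy hV).run n >>= fun p => (iterate hV n).choice p >>= (iterate hV n).choiceRest p := by
      refine (bind_assoc' _ _ _).trans (bind_congr' _ fun p _ => ?_)
      exact corestrict_bind _ _ fun q hq => succ_rest _ p hq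
    refine (congrArg (foldExec (n + 1) <$> ·) h).trans ?_
    change (foldExec n ∘ HXn.map n execAlg) <$> _ = _
    rw [comp_map, map_bind]
    congr 2
    funext p
    exact map_choice_bind _ p

/-- At `n = N` the remainders come from the empty set of executions, so the reassembled `V` is
already completed. -/
theorem mem_outcome_strategy {x : X} {V : e.T (Exec A B X)} (hV : V ∈ execs c N x) :
    V ∈ (strategy hV).outcome := by
  refine (Strategy.mem_outcome _).2 ⟨N, ?_⟩
  rw [Strategy.completed, Strategy.cone, bind_assoc, funext (ext_bang_bind_kappa N), ← bind_assoc]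
  refine PT.mem_bind_pure.2 ⟨_, ?_, foldExec_run_bind hV N⟩
  refine PT.combine_mem_bind (mem_K.2 rfl) fun p _ => ?_
  have := (iterate hV N).mem p
  rwa [Nat.sub_self] at this

end Stage

theorem exists_mem_outcome_iff (c : X → PT e (H A B X)) (x : X) (v : e.T (Exec A B X)) :
    (∃ σ : Strategy c x, v ∈ σ.outcome) ↔ v ∈ PT.iSup fun n => execs c n x := by
  rw [PT.mem_iSup fun n => execs_le_succ c n x]
  exact ⟨fun ⟨σ, hσ⟩ => σ.outcome_subset_execs hσ,
    fun ⟨_, hn⟩ => ⟨_, Stage.mem_outcome_strategy hn⟩⟩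

theorem iUnion_outcome_eq (c : X → PT e (H A B X)) (x : X) :
    (⋃ σ : Strategy c x, σ.outcome.carrier) = (PT.iSup fun n => execs c n x).carrier :=
  Set.ext fun v => Set.mem_iUnion.trans (exists_mem_outcome_iff c x v)

end Executions

/-! ### The trace map -/

section TraceMap

variable {e : Env} {A B X : Type u}

/-- One unfolding of the recursive equation for sets of traces. -/
noncomputable def traceStep (c : X → PT e (H A B X)) (t : X → PT e (Trace A B)) (x : X) :
    PT e (Trace A B) :=
  c x >>= H.ext t >>= fun q => pure (traceAlg q)

/-- The traces of `c` with fewer than `n` actions, as convex sets. -/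
noncomputable def traces (c : X → PT e (H A B X)) (n : ℕ) : X → PT e (Trace A B) :=
  (traceStep c)^[n] fun _ => PT.none

/-- The trace map. -/
noncomputable def traceMap (c : X → PT e (H A B X)) (x : X) : PT e (Trace A B) :=
  PT.iSup fun n => traces c n x

theorem traces_succ (c : X → PT e (H A B X)) (n : ℕ) :
    traces c (n + 1) = traceStep c (traces c n) :=
  Function.iterate_succ_apply' _ _ _

theorem traceStep_mono (c : X → PT e (H A B X)) {f g : X → PT e (Trace A B)}
    (h : ∀ x, f x ≤ g x) (x : X) : traceStep c f x ≤ traceStep c g x :=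
  PT.bind_mono (PT.bind_mono (PT.le_refl _) (H.ext_mono h)) fun _ => PT.le_refl _

theorem traces_le_succ (c : X → PT e (H A B X)) (n : ℕ) (x : X) :
    traces c n x ≤ traces c (n + 1) x := by
  induction n generalizing x with
  | zero => exact PT.none_le _
  | succ n ih =>
    rw [traces_succ, traces_succ c (n + 1)]
    exact traceStep_mono c ih x

theorem traces_mono (c : X → PT e (H A B X)) {m n : ℕ} (h : m ≤ n) (x : X) :
    traces c m x ≤ traces c n x :=
  Nat.le_induction (PT.le_refl _) (fun n _ ih => PT.le_trans ih (traces_le_succ c n x)) _ h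

theorem mem_traceMap {c : X → PT e (H A B X)} {x : X} {v : e.T (Trace A B)} :
    v ∈ traceMap c x ↔ ∃ n, v ∈ traces c n x :=
  PT.mem_iSup fun n => traces_le_succ c n x

theorem isTraceMap_iff (c : X → PT e (H A B X)) (t : X → PT e (Trace A B)) :
    IsTraceMap c t ↔ traceStep c t = t := by
  constructor
  · intro h
    funext x
    rw [traceStep, h x]
    simp
  · intro h x
    conv_rhs => rw [← h, traceStep]
    simp

theorem H.mem_ext_inr {f : X → PT e (Trace A B)} {a : A} {y : X} {v : e.T (H A B (Trace A B))} :
    v ∈ H.ext f (.inr (a, y)) ↔ ∃ w ∈ f y, (fun s => Sum.inr (a, s)) <$> w = v := by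
  constructor
  · intro hv
    obtain ⟨v₁, hv₁, rfl⟩ := PT.mem_bind_pure.1 hv
    obtain ⟨w, hw, rfl⟩ := PT.mem_bind_pure.1 hv₁
    exact ⟨w, hw, by simp⟩
  · rintro ⟨w, hw, rfl⟩
    exact PT.mem_bind_pure.2 ⟨_, PT.mem_bind_pure.2 ⟨w, hw, rfl⟩, by simp⟩

theorem isTraceMap_traceMap (c : X → PT e (H A B X)) : IsTraceMap c (traceMap c) := by
  rw [isTraceMap_iff]
  funext x
  refine PT.le_antisymm (fun v hv => ?_) fun v hv => ?_
  · obtain ⟨w, hw, rfl⟩ := PT.mem_bind_pure.1 hv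
    obtain ⟨u, hu, h, hh, rfl⟩ := PT.mem_bind.1 hw
    -- Continuity: the finitely many successors in `supp u` share one stage of the approximation.
    have : ∀ᶠ n in Filter.atTop, ∀ p ∈ supp u, h p ∈ H.ext (traces c n) p := by
      rw [Filter.eventually_all_finite (supp_finite u)]
      intro p hp
      have := hh p hp
      rcases p with b | ⟨a, y⟩
      · exact Filter.Eventually.of_forall fun n => this
      · obtain ⟨w, hw, hwh⟩ := H.mem_ext_inr.1 this
        obtain ⟨n, hn⟩ := mem_traceMap.1 hw
        exact Filter.eventually_atTop.2 ⟨n, fun m hm => H.mem_ext_inr.2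
          ⟨w, traces_mono c hm y hn, hwh⟩⟩
    obtain ⟨n, hn⟩ := this.exists
    refine mem_traceMap.2 ⟨n + 1, ?_⟩
    rw [traces_succ]
    exact PT.mem_bind_pure.2 ⟨_, PT.mem_bind.2 ⟨u, hu, h, hn, rfl⟩, rfl⟩
  · obtain ⟨n, hn⟩ := mem_traceMap.1 hv
    have := traces_le_succ c n x hn
    rw [traces_succ] at this
    exact traceStep_mono c (fun y w hw => mem_traceMap.2 ⟨n, hw⟩) x this

/-- Unfolding the fixed-point equation removes an action from every trace that continues, so the
length bound drives the induction. Bound `0` is impossible because supports are non-empty. -/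
theorem IsTraceMap.mem_traces {c : X → PT e (H A B X)} {t : X → PT e (Trace A B)}
    (ht : IsTraceMap c t) (n : ℕ) {x : X} {v : e.T (Trace A B)} (hv : v ∈ t x)
    (hn : ∀ s ∈ supp v, s.1.length < n) : v ∈ traces c n x := by
  induction n generalizing x v with
  | zero => exact (supp_nonempty v).elim fun s hs => (Nat.not_lt_zero _ (hn s hs)).elim
  | succ n ih =>
    rw [← (isTraceMap_iff c t).1 ht] at hv
    obtain ⟨w, hw, rfl⟩ := PT.mem_bind_pure.1 hv
    obtain ⟨u, hu, h, hh, rfl⟩ := PT.mem_bind.1 hw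
    rw [traces_succ]
    refine PT.mem_bind_pure.2 ⟨_, PT.mem_bind.2 ⟨u, hu, h, fun p hp => ?_, rfl⟩, rfl⟩
    have hp' := hh p hp
    rcases p with b | ⟨a, y⟩
    · exact hp'
    · obtain ⟨w, hw, hwh⟩ := H.mem_ext_inr.1 hp'
      refine H.mem_ext_inr.2 ⟨w, ih hw fun s hs => ?_, hwh⟩
      have h1 : traceAlg (.inr (a, s)) ∈ supp (traceAlg <$> (u >>= h)) := by
        rw [supp_map, supp_bind]
        refine Set.mem_image_of_mem _ (Set.mem_biUnion hp ?_)
        rw [← hwh, supp_map]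
        exact Set.mem_image_of_mem _ hs
      exact Nat.lt_of_succ_lt_succ (hn _ h1)

theorem IsTraceMap.eq_traceMap {c : X → PT e (H A B X)} {t : X → PT e (Trace A B)}
    (ht : IsTraceMap c t) : t = traceMap c := by
  funext x
  refine PT.le_antisymm (fun v hv => ?_) fun v hv => ?_
  · have : ∀ᶠ n in Filter.atTop, ∀ s ∈ supp v, s.1.length < n := by
      rw [Filter.eventually_all_finite (supp_finite v)]
      exact fun s _ => Filter.eventually_gt_atTop _
    obtain ⟨n, hn⟩ := this.exists
    exact mem_traceMap.2 ⟨n, ht.mem_traces n hv hn⟩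
  · obtain ⟨n, hn⟩ := mem_traceMap.1 hv
    have h : ∀ n x, traces c n x ≤ t x := by
      intro n
      induction n with
      | zero => exact fun x => PT.none_le _
      | succ n ih =>
        intro x
        rw [traces_succ, ← (isTraceMap_iff c t).1 ht]
        exact traceStep_mono c ih x
    exact h n x hn

/-- `forget` is an algebra map along the projection that drops the state added by `star c`. -/
theorem execStep_bind_forget (c : X → PT e (H A B X)) (g : X → PT e (Exec A B X)) (x : X) :
    (execStep c g x >>= fun p => pure (forget p)) =
      traceStep c (fun y => g y >>= fun p => pure (forget p)) x := by
  rw [traceStep, ← funext (H.ext_comp g fun p => pure (forget p)), funext (H.ext_pure forget)]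
  simp [execStep, star, stl, HX.ext, forget_execAlg]

theorem execs_bind_forget (c : X → PT e (H A B X)) (n : ℕ) (x : X) :
    (execs c n x >>= fun p => pure (forget p)) = traces c n x := by
  induction n generalizing x with
  | zero => exact PT.none_bind _
  | succ n ih => rw [execs_succ, traces_succ, execStep_bind_forget, funext ih]

theorem traceMap_eq (c : X → PT e (H A B X)) (x : X) :
    traceMap c x = (PT.iSup fun n => execs c n x) >>= fun p => pure (forget p) := by
  refine PT.ext_mem fun v => ?_
  simp only [mem_traceMap, ← execs_bind_forget, PT.mem_bind_pure,
    PT.mem_iSup fun n => execs_le_succ c n x]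
  exact ⟨fun ⟨n, u, hu, h⟩ => ⟨u, ⟨n, hu⟩, h⟩, fun ⟨u, ⟨n, hu⟩, h⟩ => ⟨n, u, hu, h⟩⟩

end TraceMap

end TwoPlayer

/-! ### The theorem -/

open TwoPlayer in
theorem mainTheorem2 (e : Env) {A B X : Type u} (c : X → PT e (H A B X)) :
    (∀ (x : X) (σ : Strategy c x) (m : PT e (Exec A B X)),
      (∀ n, m >>= proj n = σ.cone n) ↔ m = σ.outcome) ∧
    ∃ tr : X → PT e (Trace A B),
      (IsTraceMap c tr ∧ ∀ t, IsTraceMap c t → t = tr) ∧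
      ∀ x : X,
        (∃ hconv : cl (⋃ σ : Strategy c x, σ.outcome.carrier) =
            ⋃ σ : Strategy c x, σ.outcome.carrier,
          tr x = (⟨⋃ σ : Strategy c x, σ.outcome.carrier, hconv⟩ : PT e (Exec A B X)) >>=
            fun p => pure (forget p)) ∧
        ∀ U : e.T (Trace A B), U ∈ tr x ↔ ∃ σ : Strategy c x, σ.Forces U := by
  refine ⟨fun x σ m => σ.bind_proj_iff m, traceMap c,
    ⟨isTraceMap_traceMap c, fun t ht => ht.eq_traceMap⟩, fun x => ⟨⟨?_, ?_⟩, fun U => ?_⟩⟩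
  · rw [iUnion_outcome_eq]
    exact (PT.iSup fun n => execs c n x).convex
  · rw [traceMap_eq]
    congr 1
    exact PT.ext (iUnion_outcome_eq c x).symm
  · simp only [traceMap_eq, PT.mem_bind_pure, ← exists_mem_outcome_iff]
    exact ⟨fun ⟨V, ⟨σ, hσ⟩, h⟩ => ⟨σ, V, hσ, h⟩, fun ⟨σ, V, hσ, h⟩ => ⟨V, ⟨σ, hσ⟩, h⟩⟩
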